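/- **Definitions.** Let $C\subset\mathbb R^m$ be a Hilbert domain, that is, a nonempty open bounded convex set equipped with the following Hilbert metric $d_C$. For distinct $p,q\in C$, let $a,b$ be the points where the line through $p,q$ meets $\partial C$, labelled so that $p=(1-s)a+sb$ and $q=(1-t)a+tb$ with $0<s<t<1$; then $$d_C(p,q)=\tfrac12\ln\!\Big(\frac{1-s}{s}\cdot\frac{t}{1-t}\Big),\qquad d_C(p,p)=0 .$$ Let $B_C(p,R)=\{q\in C: d_C(p,q)<R\}$. For $p\in C$ and $v\in\mathbb R^m\setminus\{0\}$ let $t^\pm>0$ be the unique positive numbers with $p\pm t^\pm v\in\partial C$, and put $F_C(p,v)=\frac12\big(\frac1{t^-}+\frac1{t^+}\big)$ and $F_C(p,0)=0$. The Hilbert measure of $C$ is $$\mu_C(A)=\int_A\frac{\omega_m}{\mathrm{vol}\{v\in\mathbb R^m: F_C(p,v)<1\}}\,d\mathrm{vol}(p)\qquad (A\subset C\text{ Borel}),$$ where $\mathrm{vol}$ is Lebesgue measure and $\omega_m$ is the volume of the Euclidean unit ball of $\mathbb R^m$. **Theorem.** For $n\in\mathbb N=\{0,1,2,\dots\}$ let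 $P_n=(\cos 2^{-n},\sin 2^{-n})\in\mathbb R^2$, and let $\mathcal C$ be the open convex hull (the interior of the convex hull) of $\{P_n,-P_n: n\in\mathbb N\}$. Then: 1. $\mathcal C$ is a Hilbert domain in $\mathbb R^2$ containing $0$. It is not an open convex polygon (it is not the interior of the convex hull of any finite set), and $\overline{\mathcal C}$ has infinitely many vertices, where a vertex is a point of $\overline{\mathcal C}$ through which there pass two different supporting lines of $\overline{\mathcal C}$. 2. $0<\mu_{\mathcal C}(B_{\mathcal C}(0,R))<\infty$ for every $R>0$, and the volume growth entropy of $d_{\mathcal C}$ exists as a limit and vanishes: $$h(\mathcal C)=\lim_{R\to+\infty}\frac1R\ln\big[\mu_{\mathcal C}(B_{\mathcal C}(0,R))\big]=0 .$$ 3. There is a constant $K$ such that $\mu_{\mathcal C}(B_{\mathcal C}(0,R))\le K R^3$ for all $R\ge1$. -/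

import Mathlib

open Set Filter Topology MeasureTheory

noncomputable section

namespace HilbertGeometry

/-- Euclidean space of dimension `m`. -/
abbrev E (m : ℕ) : Type := EuclideanSpace ℝ (Fin m)

/-- The underlying set of a Hilbert domain: a (nonempty) open bounded convex set. -/
def IsHilbertDomain {m : ℕ} (C : Set (E m)) : Prop :=
  C.Nonempty ∧ IsOpen C ∧ Bornology.IsBounded C ∧ Convex ℝ C

/-- The positive number `t⁺` with `p + t⁺ v ∈ ∂C`. For `C` open, bounded and convex, `p ∈ C` and
`v ≠ 0` there is exactly one such number, so that the infimum is over a one-point set. -/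
def tPlus {m : ℕ} (C : Set (E m)) (p v : E m) : ℝ :=
  sInf {t : ℝ | 0 < t ∧ p + t • v ∈ frontier C}

/-- The positive number `t⁻` with `p - t⁻ v ∈ ∂C`. -/
def tMinus {m : ℕ} (C : Set (E m)) (p v : E m) : ℝ :=
  sInf {t : ℝ | 0 < t ∧ p - t • v ∈ frontier C}

open Classical in
/-- The Hilbert metric `d_C`. With `v = q - p`, the line through `p ≠ q` meets `∂C` at
`a = p - t⁻ v` and `b = p + t⁺ v`; then `p = (1 - s) a + s b` and `q = (1 - t) a + t b` for the
numbers `s`, `t` below, and the distance is half the logarithm of the cross ratio `[a, p, q, b]`. -/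
def hilbertDist {m : ℕ} (C : Set (E m)) (p q : E m) : ℝ :=
  if p = q then 0
  else
    let τm : ℝ := tMinus C p (q - p)
    let τp : ℝ := tPlus C p (q - p)
    let s : ℝ := τm / (τm + τp)
    let t : ℝ := (τm + 1) / (τm + τp)
    1 / 2 * Real.log ((1 - s) / s * (t / (1 - t)))

/-- The open ball of radius `R` about `p` for the Hilbert metric. -/
def hilbertBall {m : ℕ} (C : Set (E m)) (p : E m) (R : ℝ) : Set (E m) :=
  {q | q ∈ C ∧ hilbertDist C p q < R}

open Classical in
/-- The Finsler metric `F_C` of a Hilbert domain. -/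
def finsler {m : ℕ} (C : Set (E m)) (p v : E m) : ℝ :=
  if v = 0 then 0 else 1 / 2 * (1 / tMinus C p v + 1 / tPlus C p v)

/-- The unit open ball of the norm `F_C(p, ·)`. -/
def tangentBall {m : ℕ} (C : Set (E m)) (p : E m) : Set (E m) :=
  {v | finsler C p v < 1}

/-- The Hilbert (Busemann) measure `μ_C`: it has density `ω_m / vol (B_C(p))` on `C` with respect
to Lebesgue measure, where `ω_m` is the volume of the Euclidean unit ball. -/
def hilbertMeasure {m : ℕ} (C : Set (E m)) : Measure (E m) :=
  (volume.restrict C).withDensity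
    (fun p => volume (Metric.ball (0 : E m) 1) / volume (tangentBall C p))

/-- The volume growth entropy of `d_C` (about the origin) exists as a limit and equals `h`.
This is to be used together with `0 < μ_C (B_C(0, R)) < ∞`. -/
def HasVolumeGrowthEntropy {m : ℕ} (C : Set (E m)) (h : ℝ) : Prop :=
  Tendsto (fun R : ℝ => 1 / R * Real.log (hilbertMeasure C (hilbertBall C 0 R)).toReal)
    atTop (𝓝 h)

/-- An open convex polygon: the open convex hull of a finite set of points of the plane. -/
def IsOpenPolygon (C : Set (E 2)) : Prop :=
  ∃ F : Set (E 2), F.Finite ∧ C = interior (convexHull ℝ F)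

/-- `x` is a vertex of the convex set `K` of the plane: it is a point of `K` through which there
pass two different supporting lines of `K` (with linearly independent outer normals `u`, `w`). -/
def IsVertex (K : Set (E 2)) (x : E 2) : Prop :=
  x ∈ K ∧ ∃ u w : E 2, LinearIndependent ℝ ![u, w] ∧
    ∀ y ∈ K, inner ℝ u y ≤ inner ℝ u x ∧ inner ℝ w y ≤ inner ℝ w x

/-- The points `P_n = (cos 2⁻ⁿ, sin 2⁻ⁿ)` of the unit circle. -/
def P (n : ℕ) : E 2 :=
  !₂[Real.cos ((2 : ℝ)⁻¹ ^ n), Real.sin ((2 : ℝ)⁻¹ ^ n)]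

/-- The open convex hull of the points `P_n` and `-P_n`, `n ∈ ℕ`. -/
def domainC : Set (E 2) :=
  interior (convexHull ℝ (range P ∪ range (fun n => -P n)))

end HilbertGeometry

end

/-! The domain is centrally symmetric, so the ball of radius R about 0 is its homothetic copy of
ratio `tanh R`, which is at most 1 - e^(-2R). It is covered by O(R) parallelograms centred at 0,
each of measure O(R²).

Measure of one parallelogram (`hilbertMeasure_parallelogram_le`): let A, B lie in the closure of C
and let T be the linear map sending [-1,1]² onto conv{±A, ±B}. The tangent ball at T z contains the
T-image of a rectangle with half-sides 1 - |z₀|, 1 - |z₁|. The determinant of T cancels, and the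
density is dominated by a product whose integral over the square of half-side 1 - e^(-R) is O(R²),
independently of A, B and C.

Covering (`hilbertBall_subset`): the sectors between the angles of consecutive points P_{n+1}, P_n,
and the sector from angle 1 to π, are bounded by edges of the hull. The infinitely many edges of
angle below 2^(-N) are replaced by the single chord from angle 0 to 2^(-N). For N ≥ 2R this chord is
so close to the circle that the ball does not reach it (`tanh_lt_mul_cos`). Hence about 2R
parallelograms suffice, the growth is at most cubic, and the entropy vanishes.

The hull is not a polygon because every P_{n+1} is a vertex, while the vertices of a polygon are
among its finitely many generators. -/

namespace HilbertGeometry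

/-! ### Exit times along rays, tangent balls, and metric balls about a centre of symmetry. -/

section General

variable {m : ℕ} {C : Set (E m)} {p v : E m}

theorem tMinus_eq_tPlus_neg (C : Set (E m)) (p v : E m) : tMinus C p v = tPlus C p (-v) := by
  simp [tMinus, tPlus, sub_eq_add_neg]

/-- A segment is connected, so it cannot be split between the disjoint open sets `C` and `(closure
C)ᶜ` and must meet the frontier. -/
theorem exists_frontier_of_notMem (hC : IsOpen C) (hp : p ∈ C) {t : ℝ} (ht : 0 < t)
    (h : p + t • v ∉ C) : ∃ s ≤ t, 0 < s ∧ p + s • v ∈ frontier C := by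
  have hc : ContinuousOn (fun s : ℝ => p + s • v) (Icc 0 t) := by fun_prop
  by_contra! hn
  have hcov : (fun s : ℝ => p + s • v) '' Icc 0 t ⊆ C ∪ (closure C)ᶜ := by
    rintro _ ⟨s, hs, rfl⟩
    by_contra hmem
    simp only [mem_union, mem_compl_iff, not_or, not_not] at hmem
    have hs0 : 0 < s := hs.1.lt_of_ne (by rintro rfl; exact hmem.1 (by simpa using hp))
    exact hn s hs.2 hs0 (by rw [hC.frontier_eq]; exact ⟨hmem.2, hmem.1⟩)
  obtain ⟨x, -, hx1, hx2⟩ := isPreconnected_Icc.image _ hc C (closure C)ᶜ hC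
    isClosed_closure.isOpen_compl hcov ⟨p, ⟨0, by simp [ht.le], by simp⟩, hp⟩
    ⟨p + t • v, ⟨t, by simp [ht.le], rfl⟩, fun hcl => hn t le_rfl ht
      (by rw [hC.frontier_eq]; exact ⟨hcl, h⟩)⟩
  exact hx2 (subset_closure hx1)

theorem exists_notMem_of_isBounded (hb : Bornology.IsBounded C) (hv : v ≠ 0) :
    ∃ t : ℝ, 0 < t ∧ p + t • v ∉ C := by
  obtain ⟨M, hM0, hM⟩ := hb.subset_closedBall_lt 0 p
  have hv' : 0 < ‖v‖ := norm_pos_iff.2 hv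
  refine ⟨(M + 1) / ‖v‖, by positivity, fun h => ?_⟩
  have h1 := hM h
  rw [mem_closedBall_iff_norm, add_sub_cancel_left, norm_smul, Real.norm_of_nonneg (by positivity),
    div_mul_cancel₀ _ hv'.ne'] at h1
  linarith

/-- For `t ≥ 0`, the point `p + t v` is in `C` exactly when the ray has not yet met the
boundary. -/
theorem lt_tPlus_iff (h : IsHilbertDomain C) (hp : p ∈ C) (hv : v ≠ 0) {t : ℝ} (ht : 0 ≤ t) :
    t < tPlus C p v ↔ p + t • v ∈ C := by
  obtain ⟨-, ho, hb, hc⟩ := h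
  have hbdd : BddBelow {t : ℝ | 0 < t ∧ p + t • v ∈ frontier C} := ⟨0, fun s hs => hs.1.le⟩
  constructor
  · intro hlt
    by_contra hn
    have ht0 : 0 < t := ht.lt_of_ne (by rintro rfl; exact hn (by simpa using hp))
    obtain ⟨s, hst, hs⟩ := exists_frontier_of_notMem ho hp ht0 hn
    exact absurd (csInf_le hbdd hs) (not_le.2 (hst.trans_lt hlt))
  · intro hm
    have hcont : Continuous fun s : ℝ => p + s • v := by fun_prop
    obtain ⟨ε, hε, hball⟩ := Metric.isOpen_iff.1 (ho.preimage hcont) t hm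
    have hm' : p + (t + ε / 2) • v ∈ C := hball (by simp [abs_of_pos hε, hε])
    refine lt_of_lt_of_le (show t < t + ε / 2 by linarith) (le_csInf ?_ ?_)
    · obtain ⟨s, hs0, hs⟩ := exists_notMem_of_isBounded (p := p) hb hv
      obtain ⟨r, -, hr⟩ := exists_frontier_of_notMem ho hp hs0 hs
      exact ⟨r, hr⟩
    · rintro s ⟨hs0, hs⟩
      by_contra! hlt
      rw [ho.frontier_eq] at hs
      refine hs.2 ?_
      have hd : 0 < t + ε / 2 := by linarith
      have := hc.add_smul_mem hp hm' (t := s / (t + ε / 2))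
        ⟨by positivity, (div_le_one hd).2 hlt.le⟩
      rwa [smul_smul, div_mul_cancel₀ _ hd.ne'] at this

theorem tPlus_pos (h : IsHilbertDomain C) (hp : p ∈ C) (hv : v ≠ 0) : 0 < tPlus C p v :=
  (lt_tPlus_iff h hp hv le_rfl).2 (by simpa using hp)

/-- The unit ball of the Finsler norm contains the largest symmetric subset of `C - p`. -/
theorem mem_tangentBall (h : IsHilbertDomain C) (hp : p ∈ C) (h1 : p + v ∈ C) (h2 : p - v ∈ C) :
    v ∈ tangentBall C p := by
  by_cases hv : v = 0
  · simp [tangentBall, finsler, hv]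
  have a1 : 1 < tPlus C p v := (lt_tPlus_iff h hp hv zero_le_one).2 (by simpa using h1)
  have a2 : 1 < tMinus C p v := by
    rw [tMinus_eq_tPlus_neg]
    exact (lt_tPlus_iff h hp (neg_ne_zero.2 hv) zero_le_one).2
      (by simpa [← sub_eq_add_neg] using h2)
  have b1 : 1 / tPlus C p v < 1 := by rw [div_lt_one (by linarith)]; exact a1
  have b2 : 1 / tMinus C p v < 1 := by rw [div_lt_one (by linarith)]; exact a2
  simp only [tangentBall, finsler, hv, if_false, mem_ofPred_eq]
  linarith

/-- If ‖v‖ > 4M, half of v already exceeds the diameter bound 2M, so both exit times are at most 1/2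
and the norm of v is at least 2. This bounds the density of the measure below. -/
theorem tangentBall_subset_closedBall (h : IsHilbertDomain C) {M : ℝ}
    (hM : C ⊆ Metric.closedBall 0 M) (hp : p ∈ C) :
    tangentBall C p ⊆ Metric.closedBall 0 (4 * M) := by
  intro v hv
  have hpM : ‖p‖ ≤ M := by simpa using hM hp
  rw [mem_closedBall_zero_iff]
  by_contra! hlt
  have hv0 : v ≠ 0 := by
    rintro rfl
    rw [norm_zero] at hlt
    linarith [norm_nonneg p]
  have key : ∀ w : E m, ‖w‖ = ‖v‖ → w ≠ 0 → 2 ≤ 1 / tPlus C p w := by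
    intro w hw hw0
    have hpos := tPlus_pos h hp hw0
    have : ¬ (1 / 2 : ℝ) < tPlus C p w := by
      rw [lt_tPlus_iff h hp hw0 (by norm_num)]
      intro hmem
      have h1 : ‖p + (1 / 2 : ℝ) • w‖ ≤ M := by simpa using hM hmem
      have h2 : ‖(1 / 2 : ℝ) • w‖ ≤ ‖p + (1 / 2 : ℝ) • w‖ + ‖p‖ := by
        simpa using norm_sub_le (p + (1 / 2 : ℝ) • w) p
      rw [norm_smul, hw] at h2
      norm_num at h2
      norm_num at h1
      linarith
    rw [le_div_iff₀ hpos]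
    linarith
  have h1 := key v rfl hv0
  have h2 := key (-v) (norm_neg v) (neg_ne_zero.2 hv0)
  simp only [tangentBall, finsler, hv0, if_false, mem_ofPred_eq, tMinus_eq_tPlus_neg] at hv
  linarith

theorem tPlus_zero_neg (hs : ∀ x ∈ C, -x ∈ C) (q : E m) : tPlus C 0 (-q) = tPlus C 0 q := by
  have hn : Neg.neg ⁻¹' C = C := by
    ext x
    exact ⟨fun hx => by simpa using hs _ hx, fun hx => hs _ hx⟩
  have hf : ∀ x, -x ∈ frontier C ↔ x ∈ frontier C := fun x => by
    have := (Homeomorph.neg (E m)).preimage_frontier C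
    rw [Homeomorph.coe_neg, hn] at this
    exact Set.ext_iff.1 this x
  simp only [tPlus, zero_add, smul_neg, hf]

/-- Balls about the centre of a centrally symmetric Hilbert domain are homothetic to the domain,
with ratio `tanh R`. -/
theorem mem_hilbertBall_zero_iff (h : IsHilbertDomain C) (hs : ∀ x ∈ C, -x ∈ C) (h0 : 0 ∈ C)
    {R : ℝ} (hR : 0 < R) (q : E m) :
    q ∈ hilbertBall C 0 R ↔ (Real.tanh R)⁻¹ • q ∈ C := by
  have hT0 : 0 < Real.tanh R := by
    rw [Real.tanh_eq_sinh_div_cosh]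
    exact div_pos (Real.sinh_pos_iff.2 hR) (Real.cosh_pos R)
  by_cases hq : q = 0
  · simp [hq, hilbertBall, hilbertDist, h0, hR]
  have hτ : 0 < tPlus C 0 q := tPlus_pos h h0 hq
  have hT1 : 1 < (Real.tanh R)⁻¹ := (one_lt_inv₀ hT0).2 (Real.tanh_lt_one R)
  have e1 : (Real.tanh R)⁻¹ • q ∈ C ↔ (Real.tanh R)⁻¹ < tPlus C 0 q := by
    rw [lt_tPlus_iff h h0 hq (by positivity), zero_add]
  have e2 : q ∈ C ↔ 1 < tPlus C 0 q := by
    rw [lt_tPlus_iff h h0 hq zero_le_one, zero_add, one_smul]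
  rw [hilbertBall, mem_ofPred_eq, e1, e2]
  by_cases hτ1 : 1 < tPlus C 0 q
  swap
  · exact ⟨fun hh => absurd hh.1 hτ1, fun hh => absurd (hT1.trans hh) hτ1⟩
  simp only [hτ1, true_and]
  simp only [hilbertDist, if_neg (Ne.symm hq), sub_zero, tMinus_eq_tPlus_neg, tPlus_zero_neg hs]
  generalize tPlus C 0 q = τ at *
  -- By symmetry both exit times equal τ, and the cross ratio collapses to (τ + 1)/(τ - 1); it is
  -- below e^(2R) exactly when τ > 1/tanh R.
  have e3 : (1 - τ / (τ + τ)) / (τ / (τ + τ)) * ((τ + 1) / (τ + τ) / (1 - (τ + 1) / (τ + τ)))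
      = (τ + 1) / (τ - 1) := by
    have : τ - 1 ≠ 0 := by linarith
    have h3 : 1 - (τ + 1) / (τ + τ) = (τ - 1) / (τ + τ) := by field_simp; ring
    have h4 : 1 - τ / (τ + τ) = τ / (τ + τ) := by field_simp; ring
    rw [h3, h4]
    field_simp
  have hτm : 0 < τ - 1 := by linarith
  have e4 : 1 / 2 * Real.log ((τ + 1) / (τ - 1)) < R ↔
      (τ + 1) / (τ - 1) < Real.exp (2 * R) := by
    rw [← Real.log_lt_iff_lt_exp (by positivity)]
    constructor <;> intro <;> linarith
  rw [e3, e4, div_lt_iff₀ hτm, inv_lt_iff_one_lt_mul₀ hT0, Real.tanh_eq_sinh_div_cosh,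
    Real.sinh_eq, Real.cosh_eq]
  have hE : Real.exp (2 * R) = Real.exp R * Real.exp R := by rw [← Real.exp_add]; ring_nf
  have hE' : Real.exp (-R) = (Real.exp R)⁻¹ := Real.exp_neg R
  have hpos := Real.exp_pos R
  rw [hE, hE']
  generalize Real.exp R = x at *
  have : (x - x⁻¹) / 2 / ((x + x⁻¹) / 2) = (x * x - 1) / (x * x + 1) := by field_simp
  rw [this, ← mul_div_assoc, lt_div_iff₀ (by positivity)]
  constructor <;> intro <;> linarith

end General

end HilbertGeometry
namespace HilbertGeometry

/-! ### Comparison of the Hilbert measure with a product density on a square. -/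

section Square

variable {C : Set (E 2)} {A B : E 2}

theorem measurePreserving_coords :
    MeasurePreserving (fun z : E 2 => (z 0, z 1)) (volume : Measure (E 2))
      (volume : Measure (ℝ × ℝ)) :=
  (volume_preserving_finTwoArrow ℝ).comp (PiLp.volume_preserving_ofLp (Fin 2))

theorem volume_box (c d a b : ℝ) :
    volume {z : E 2 | z 0 ∈ Ioo c d ∧ z 1 ∈ Ioo a b} =
      ENNReal.ofReal (d - c) * ENNReal.ofReal (b - a) := by
  have := measurePreserving_coords.measure_preimage
    (measurableSet_Ioo.prod measurableSet_Ioo : MeasurableSet (Ioo c d ×ˢ Ioo a b)).nullMeasurableSet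
  rw [Measure.volume_eq_prod, Measure.prod_prod, Real.volume_Ioo, Real.volume_Ioo] at this
  exact this

theorem lintegral_square {f : ℝ → ENNReal} (hf : Measurable f) {s : Set ℝ} (hs : MeasurableSet s) :
    ∫⁻ z in {z : E 2 | z 0 ∈ s ∧ z 1 ∈ s}, f (z 0) * f (z 1) = (∫⁻ x in s, f x) ^ 2 := by
  have := measurePreserving_coords.setLIntegral_comp_preimage (hs.prod hs)
    (f := fun w => f w.1 * f w.2) (by fun_prop)
  rw [Measure.volume_eq_prod, ← Measure.prod_restrict,
    lintegral_prod_mul hf.aemeasurable hf.aemeasurable] at this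
  rw [sq]
  exact this

/-- The linear map that sends the square `[-1, 1]²` onto the parallelogram with
vertices `±A`, `±B`. -/
noncomputable def squareMap (A B : E 2) : E 2 →L[ℝ] E 2 :=
  (EuclideanSpace.proj (0 : Fin 2) : E 2 →L[ℝ] ℝ).smulRight ((1 / 2 : ℝ) • (A + B)) +
    (EuclideanSpace.proj (1 : Fin 2) : E 2 →L[ℝ] ℝ).smulRight ((1 / 2 : ℝ) • (A - B))

theorem squareMap_apply (A B z : E 2) :
    squareMap A B z = ((z 0 + z 1) / 2) • A + ((z 0 - z 1) / 2) • B := by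
  change z 0 • (1 / 2 : ℝ) • (A + B) + z 1 • (1 / 2 : ℝ) • (A - B) = _
  module

theorem squareMap_injective (hAB : LinearIndependent ℝ ![A, B]) :
    Function.Injective (squareMap A B) := by
  rw [injective_iff_map_eq_zero]
  intro z hz
  rw [squareMap_apply] at hz
  obtain ⟨h1, h2⟩ := LinearIndependent.pair_iff.1 hAB _ _ hz
  ext i
  fin_cases i <;> simp <;> linarith

theorem squareMap_det_ne_zero (hAB : LinearIndependent ℝ ![A, B]) :
    LinearMap.det (squareMap A B : E 2 →ₗ[ℝ] E 2) ≠ 0 := by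
  intro h
  have := LinearMap.bot_lt_ker_of_det_eq_zero h
  rw [LinearMap.ker_eq_bot.2 (squareMap_injective hAB)] at this
  exact lt_irrefl _ this

/-- The open parallelogram with vertices `±A`, `±B` lies in every convex set that contains these
points. -/
theorem squareMap_mem_of_convex {K : Set (E 2)} (hK : Convex ℝ K) (hs : ∀ x ∈ K, -x ∈ K)
    (hA : A ∈ K) (hB : B ∈ K) {z : E 2} (h0 : z 0 ∈ Ioo (-1 : ℝ) 1) (h1 : z 1 ∈ Ioo (-1 : ℝ) 1) :
    squareMap A B z ∈ K := by
  -- The bilinear weights (1 ± z₀)(1 ± z₁)/4 express a point of the square as a convex combination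
  -- of its corners.
  have e : squareMap A B z = ((1 + z 0) * (1 + z 1) / 4) • A + ((1 + z 0) * (1 - z 1) / 4) • B +
      ((1 - z 0) * (1 + z 1) / 4) • (-B) + ((1 - z 0) * (1 - z 1) / 4) • (-A) := by
    rw [squareMap_apply]
    module
  have key := hK.sum_mem (t := Finset.univ)
    (w := ![(1 + z 0) * (1 + z 1) / 4, (1 + z 0) * (1 - z 1) / 4, (1 - z 0) * (1 + z 1) / 4,
      (1 - z 0) * (1 - z 1) / 4]) (z := ![A, B, -B, -A])
    (by
      have a1 : 0 ≤ 1 + z 0 := by linarith [h0.1]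
      have a2 : 0 ≤ 1 - z 0 := by linarith [h0.2]
      have a3 : 0 ≤ 1 + z 1 := by linarith [h1.1]
      have a4 : 0 ≤ 1 - z 1 := by linarith [h1.2]
      intro i _
      fin_cases i <;> simp <;> positivity)
    (by simp [Fin.sum_univ_four]; ring)
    (by intro i _; fin_cases i <;> simp [hA, hB, hs _ hA, hs _ hB])
  rw [e]
  simpa [Fin.sum_univ_four] using key

/-- The same parallelogram lies in the interior. -/
theorem squareMap_mem_interior {K : Set (E 2)} (hK : Convex ℝ K) (hs : ∀ x ∈ K, -x ∈ K)
    (hA : A ∈ K) (hB : B ∈ K) (hAB : LinearIndependent ℝ ![A, B]) {z : E 2}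
    (h0 : z 0 ∈ Ioo (-1 : ℝ) 1) (h1 : z 1 ∈ Ioo (-1 : ℝ) 1) :
    squareMap A B z ∈ interior K := by
  have hopen : IsOpenMap (squareMap A B) := by
    refine (squareMap A B).isOpenMap ?_
    exact LinearMap.surjective_of_injective (f := (squareMap A B : E 2 →ₗ[ℝ] E 2))
      (squareMap_injective hAB)
  have hU : IsOpen {z : E 2 | z 0 ∈ Ioo (-1 : ℝ) 1 ∧ z 1 ∈ Ioo (-1 : ℝ) 1} :=
    (isOpen_Ioo.preimage (by fun_prop : Continuous fun z : E 2 => z 0)).inter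
      (isOpen_Ioo.preimage (by fun_prop : Continuous fun z : E 2 => z 1))
  refine interior_maximal ?_ (hopen _ hU) ⟨z, ⟨h0, h1⟩, rfl⟩
  rintro _ ⟨w, hw, rfl⟩
  exact squareMap_mem_of_convex hK hs hA hB hw.1 hw.2

/-- Dominating 1/(1 - |x|) by 1/(1 + x) + 1/(1 - x) removes the absolute value; the antiderivative
log((1 + x)/(1 - x)) is linear in R at the cutoff 1 - e^(-R). -/
theorem lintegral_inv_one_sub_abs_le {R : ℝ} (hR : 0 < R) :
    ∫⁻ x in Ioo (-(1 - Real.exp (-R))) (1 - Real.exp (-R)), ENNReal.ofReal (1 / (1 - |x|)) ≤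
      ENNReal.ofReal (2 * Real.log 2 + 2 * R) := by
  have hE := Real.exp_pos (-R)
  have hE1 : Real.exp (-R) < 1 := by simpa using hR
  set c := 1 - Real.exp (-R) with hc
  have hc0 : 0 < c := by linarith
  have hc1 : c < 1 := by linarith
  have hle : -c ≤ c := by linarith
  have hderiv : ∀ x ∈ uIcc (-c) c, HasDerivAt (fun x => Real.log (1 + x) - Real.log (1 - x))
      (1 / (1 + x) + 1 / (1 - x)) x := by
    intro x hx
    rw [uIcc_of_le hle] at hx
    have p1 : 1 + x ≠ 0 := by linarith [hx.1]
    have p2 : 1 - x ≠ 0 := by linarith [hx.2]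
    have d1 := ((hasDerivAt_id x).const_add 1).log p1
    have d2 := ((hasDerivAt_id x).const_sub 1).log p2
    exact (d1.sub d2).congr_deriv (by simp only [id]; ring)
  have hcont : ContinuousOn (fun x : ℝ => 1 / (1 + x) + 1 / (1 - x)) (uIcc (-c) c) := by
    rw [uIcc_of_le hle]
    refine ContinuousOn.add ?_ ?_
    · exact continuousOn_const.div (by fun_prop) fun x hx => by linarith [hx.1]
    · exact continuousOn_const.div (by fun_prop) fun x hx => by linarith [hx.2]
  have hint : IntervalIntegrable (fun x : ℝ => 1 / (1 + x) + 1 / (1 - x)) volume (-c) c :=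
    hcont.intervalIntegrable
  have hval := intervalIntegral.integral_eq_sub_of_hasDerivAt hderiv hint
  have hion := (intervalIntegrable_iff_integrableOn_Ioo_of_le hle).1 hint
  calc ∫⁻ x in Ioo (-c) c, ENNReal.ofReal (1 / (1 - |x|))
      ≤ ∫⁻ x in Ioo (-c) c, ENNReal.ofReal (1 / (1 + x) + 1 / (1 - x)) := by
        refine setLIntegral_mono' measurableSet_Ioo fun x hx => ENNReal.ofReal_le_ofReal ?_
        have p1 : 0 < 1 + x := by linarith [hx.1]
        have p2 : 0 < 1 - x := by linarith [hx.2]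
        rcases abs_cases x with ⟨h, -⟩ | ⟨h, -⟩ <;> rw [h]
        · have := one_div_pos.2 p1
          linarith
        · have := one_div_pos.2 p2
          rw [sub_neg_eq_add]
          linarith
    _ = ENNReal.ofReal (∫ x in Ioo (-c) c, (1 / (1 + x) + 1 / (1 - x))) := by
        rw [ofReal_integral_eq_lintegral_ofReal hion]
        refine (ae_restrict_mem measurableSet_Ioo).mono fun x hx => ?_
        have p1 : 0 < 1 + x := by linarith [hx.1]
        have p2 : 0 < 1 - x := by linarith [hx.2]
        show (0 : ℝ) ≤ _
        positivity
    _ ≤ ENNReal.ofReal (2 * Real.log 2 + 2 * R) := by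
        refine ENNReal.ofReal_le_ofReal ?_
        rw [← integral_Ioc_eq_integral_Ioo, ← intervalIntegral.integral_of_le hle, hval]
        have l1 : Real.log (1 + c) ≤ Real.log 2 := Real.log_le_log (by linarith) (by linarith)
        have l2 : Real.log (1 - c) = -R := by
          rw [hc, sub_sub_cancel, Real.log_exp]
        rw [sub_neg_eq_add, ← sub_eq_add_neg, l2]
        linarith

/-- The part of a symmetric plane Hilbert domain in the homothetic parallelogram
`(1 - exp (-R)) • conv {±A, ±B}` has a measure that is quadratic in `R`, uniformly in `A`, `B` and
the domain. -/
theorem hilbertMeasure_parallelogram_le (h : IsHilbertDomain C) (hs : ∀ x ∈ C, -x ∈ C)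
    (hA : A ∈ closure C) (hB : B ∈ closure C) (hAB : LinearIndependent ℝ ![A, B])
    {R : ℝ} (hR : 0 < R) :
    hilbertMeasure C (squareMap A B '' {z : E 2 |
      z 0 ∈ Ioo (-(1 - Real.exp (-R))) (1 - Real.exp (-R)) ∧
      z 1 ∈ Ioo (-(1 - Real.exp (-R))) (1 - Real.exp (-R))}) ≤
      volume (Metric.ball (0 : E 2) 1) * ENNReal.ofReal (2 * Real.log 2 + 2 * R) ^ 2 := by
  have hE := Real.exp_pos (-R)
  have hE1 : Real.exp (-R) < 1 := by simpa using hR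
  set c := 1 - Real.exp (-R) with hc
  have hc0 : 0 < c := by linarith
  have hc1 : c < 1 := by linarith
  set ω := volume (Metric.ball (0 : E 2) 1)
  set Q : Set (E 2) := {z : E 2 | z 0 ∈ Ioo (-c) c ∧ z 1 ∈ Ioo (-c) c}
  have hQ : MeasurableSet Q :=
    (measurableSet_Ioo.preimage (by fun_prop : Measurable fun z : E 2 => z 0)).inter
      (measurableSet_Ioo.preimage (by fun_prop : Measurable fun z : E 2 => z 1))
  have hinj := squareMap_injective hAB
  have hdet := squareMap_det_ne_zero hAB
  have hsc : ∀ x ∈ closure C, -x ∈ closure C := fun x hx =>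
    map_mem_closure continuous_neg hx hs
  have hmemC : ∀ z : E 2, z 0 ∈ Ioo (-1 : ℝ) 1 → z 1 ∈ Ioo (-1 : ℝ) 1 → squareMap A B z ∈ C := by
    intro z h0 h1
    have hi : interior C = C := h.2.1.interior_eq
    have := squareMap_mem_interior h.2.2.2.closure hsc hA hB hAB h0 h1
    rwa [h.2.2.2.interior_closure_eq_interior_of_nonempty_interior (by rw [hi]; exact h.1), hi]
      at this
  have hmeas : MeasurableSet (squareMap A B '' Q) :=
    hQ.image_of_continuousOn_injOn (squareMap A B).continuous.continuousOn hinj.injOn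
  rw [hilbertMeasure, withDensity_apply _ hmeas]
  refine (lintegral_mono' (Measure.restrict_mono_measure Measure.restrict_le_self _) le_rfl).trans ?_
  rw [lintegral_image_eq_lintegral_abs_det_fderiv_mul volume hQ
    (fun z _ => (squareMap A B).hasFDerivAt.hasFDerivWithinAt) hinj.injOn]
  calc ∫⁻ z in Q, ENNReal.ofReal |(squareMap A B).det| *
        (ω / volume (tangentBall C (squareMap A B z)))
      ≤ ∫⁻ z in Q, ω * (ENNReal.ofReal (1 / (1 - |z 0|)) * ENNReal.ofReal (1 / (1 - |z 1|))) := by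
        refine setLIntegral_mono' hQ fun z hz => ?_
        have z0 : |z 0| < c := abs_lt.2 hz.1
        have z1 : |z 1| < c := abs_lt.2 hz.2
        set a := 1 - |z 0| with ha
        set b := 1 - |z 1| with hb
        have ha0 : 0 < a := by linarith
        have hb0 : 0 < b := by linarith
        -- Moving from z by less than a and b in the two coordinates, in either direction, stays
        -- inside the unit square, so the image vector fits symmetrically in C.
        have hsub : squareMap A B '' {w : E 2 | w 0 ∈ Ioo (-a) a ∧ w 1 ∈ Ioo (-b) b} ⊆
            tangentBall C (squareMap A B z) := by
          rintro _ ⟨w, ⟨w0, w1⟩, rfl⟩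
          have q0 := neg_abs_le (z 0)
          have q1 := neg_abs_le (z 1)
          have r0 := le_abs_self (z 0)
          have r1 := le_abs_self (z 1)
          refine mem_tangentBall h
            (hmemC _ ⟨by linarith, by linarith⟩ ⟨by linarith, by linarith⟩) ?_ ?_
          · rw [← map_add]
            apply hmemC <;> simp only [PiLp.add_apply] <;> constructor <;>
              linarith [w0.1, w0.2, w1.1, w1.2]
          · rw [← map_sub]
            apply hmemC <;> simp only [PiLp.sub_apply] <;> constructor <;>
              linarith [w0.1, w0.2, w1.1, w1.2]
        have hvol := measure_mono (μ := volume) hsub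
        rw [Measure.addHaar_image_continuousLinearMap, volume_box] at hvol
        set δ := |LinearMap.det (squareMap A B : E 2 →ₗ[ℝ] E 2)|
        have hδ : 0 < δ := abs_pos.2 hdet
        -- The rectangle has area 4ab; the factor 4 is discarded. The factor δ cancels against the
        -- Jacobian, which makes the bound uniform.
        have hlow : ENNReal.ofReal (δ * (a * b)) ≤ volume (tangentBall C (squareMap A B z)) := by
          refine le_trans ?_ hvol
          rw [← ENNReal.ofReal_mul (by linarith), ← ENNReal.ofReal_mul hδ.le]
          refine ENNReal.ofReal_le_ofReal (mul_le_mul_of_nonneg_left ?_ hδ.le)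
          nlinarith [mul_pos ha0 hb0]
        have hx : 0 < δ * (a * b) := by positivity
        calc ENNReal.ofReal δ * (ω / volume (tangentBall C (squareMap A B z)))
            ≤ ENNReal.ofReal δ * (ω / ENNReal.ofReal (δ * (a * b))) := by gcongr
          _ = ω * ENNReal.ofReal (δ * (δ * (a * b))⁻¹) := by
              rw [div_eq_mul_inv, ← ENNReal.ofReal_inv_of_pos hx, ENNReal.ofReal_mul hδ.le]
              ring
          _ = ω * (ENNReal.ofReal (1 / a) * ENNReal.ofReal (1 / b)) := by
              rw [← ENNReal.ofReal_mul (by positivity)]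
              congr 2
              field_simp
    _ = ω * (∫⁻ x in Ioo (-c) c, ENNReal.ofReal (1 / (1 - |x|))) ^ 2 := by
        rw [lintegral_const_mul' _ _ Metric.isBounded_ball.measure_lt_top.ne]
        congr 1
        exact lintegral_square (f := fun x => ENNReal.ofReal (1 / (1 - |x|))) (by fun_prop)
          measurableSet_Ioo
    _ ≤ _ := by
        gcongr
        exact lintegral_inv_one_sub_abs_le hR

/-- Tangent balls lie in one fixed Euclidean ball, so the density has a positive lower bound on C.
-/
theorem hilbertMeasure_pos (h : IsHilbertDomain C) {U : Set (E 2)} (hU : IsOpen U)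
    (hne : U.Nonempty) (hUC : U ⊆ C) : 0 < hilbertMeasure C U := by
  obtain ⟨M, hM⟩ := h.2.2.1.subset_closedBall 0
  have hω : 0 < volume (Metric.ball (0 : E 2) 1) := Metric.measure_ball_pos _ _ one_pos
  have hfin : volume (Metric.closedBall (0 : E 2) (4 * M)) ≠ ⊤ :=
    Metric.isBounded_closedBall.measure_lt_top.ne
  rw [hilbertMeasure, withDensity_apply _ hU.measurableSet, Measure.restrict_restrict hU.measurableSet,
    inter_eq_left.2 hUC]
  calc 0 < volume (Metric.ball (0 : E 2) 1) / volume (Metric.closedBall (0 : E 2) (4 * M)) *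
        volume U := ENNReal.mul_pos (ENNReal.div_pos hω.ne' hfin).ne' (hU.measure_pos volume hne).ne'
    _ = ∫⁻ _ in U, volume (Metric.ball (0 : E 2) 1) / volume (Metric.closedBall (0 : E 2) (4 * M)) := by
        rw [setLIntegral_const]
    _ ≤ _ := by
        refine setLIntegral_mono' hU.measurableSet fun p hp => ?_
        gcongr
        exact tangentBall_subset_closedBall h hM (hUC hp)

end Square

end HilbertGeometry
namespace HilbertGeometry

/-! ### Sectors of the unit circle and estimates for the ratio `tanh R`. -/

section Circle

/-- The point of the unit circle with angle `θ`. -/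
noncomputable def circlePt (θ : ℝ) : E 2 := !₂[Real.cos θ, Real.sin θ]

theorem inner_circlePt (a : ℝ) (y : E 2) :
    inner ℝ (circlePt a) y = Real.cos a * y 0 + Real.sin a * y 1 := by
  simp [circlePt, PiLp.inner_apply, Fin.sum_univ_two, mul_comm]

theorem inner_circlePt_circlePt (a b : ℝ) :
    inner ℝ (circlePt a) (circlePt b) = Real.cos (a - b) := by
  rw [inner_circlePt, Real.cos_sub]
  rfl

theorem norm_circlePt (a : ℝ) : ‖circlePt a‖ = 1 := by
  simp [circlePt, EuclideanSpace.norm_eq, Fin.sum_univ_two]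

theorem neg_circlePt (a : ℝ) : -circlePt a = circlePt (a + Real.pi) := by
  ext i
  fin_cases i <;> simp [circlePt]

theorem continuous_circlePt : Continuous circlePt := by
  unfold circlePt
  fun_prop

theorem linearIndependent_circlePt {a b : ℝ} (h : Real.sin (b - a) ≠ 0) :
    LinearIndependent ℝ ![circlePt a, circlePt b] := by
  rw [LinearIndependent.pair_iff]
  intro s t hst
  have h0 : s * Real.cos a + t * Real.cos b = 0 := by
    simpa [circlePt] using congrArg (fun z : E 2 => z 0) hst
  have h1 : s * Real.sin a + t * Real.sin b = 0 := by
    simpa [circlePt] using congrArg (fun z : E 2 => z 1) hst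
  rw [Real.sin_sub] at h
  constructor
  · refine (mul_eq_zero.1 (?_ : s * (Real.sin b * Real.cos a - Real.cos b * Real.sin a) = 0)).resolve_right h
    linear_combination Real.sin b * h0 - Real.cos b * h1
  · refine (mul_eq_zero.1 (?_ : t * (Real.sin b * Real.cos a - Real.cos b * Real.sin a) = 0)).resolve_right h
    linear_combination Real.cos a * h1 - Real.sin a * h0

/-- Polar coordinates up to sign. -/
theorem exists_polar (p : E 2) : ∃ r θ : ℝ, 0 ≤ r ∧ θ ∈ Icc 0 Real.pi ∧
    (p = r • circlePt θ ∨ -p = r • circlePt θ) := by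
  have e : p = ‖(⟨p 0, p 1⟩ : ℂ)‖ • circlePt (Complex.arg ⟨p 0, p 1⟩) := by
    ext i
    fin_cases i
    · simp [circlePt]
    · simp [circlePt]
  have h1 := Complex.neg_pi_lt_arg ⟨p 0, p 1⟩
  have h2 := Complex.arg_le_pi ⟨p 0, p 1⟩
  generalize Complex.arg ⟨p 0, p 1⟩ = θ at *
  generalize hr : ‖(⟨p 0, p 1⟩ : ℂ)‖ = r at *
  have hr0 : 0 ≤ r := hr ▸ norm_nonneg _
  by_cases h : 0 ≤ θ
  · exact ⟨r, θ, hr0, ⟨h, h2⟩, Or.inl e⟩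
  · refine ⟨r, θ + Real.pi, hr0, ⟨by linarith, by linarith⟩, Or.inr ?_⟩
    rw [← neg_circlePt, smul_neg, ← e]

/-- The parallelogram with ratio `1 - exp (-R)` spanned by two points of the circle. -/
noncomputable def circleParallelogram (α β R : ℝ) : Set (E 2) :=
  squareMap (circlePt α) (circlePt β) '' {z : E 2 |
      z 0 ∈ Ioo (-(1 - Real.exp (-R))) (1 - Real.exp (-R)) ∧
      z 1 ∈ Ioo (-(1 - Real.exp (-R))) (1 - Real.exp (-R))}

theorem neg_mem_circleParallelogram {α β R : ℝ} {p : E 2} (h : -p ∈ circleParallelogram α β R) :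
    p ∈ circleParallelogram α β R := by
  obtain ⟨z, ⟨h0, h1⟩, hz⟩ := h
  refine ⟨-z, ⟨?_, ?_⟩, by rw [map_neg, hz, neg_neg]⟩
  · exact ⟨neg_lt_neg h0.2, neg_lt.1 h0.1⟩
  · exact ⟨neg_lt_neg h1.2, neg_lt.1 h1.1⟩

/-- In the sector the point is aA + bB with a, b ≥ 0. Pairing with the bisector gives (a + b) cos((β
- α)/2), so the hypothesis says a + b < c, and the square coordinates a + b, a - b lie in (-c, c).
-/
theorem smul_circlePt_mem_circleParallelogram {α β θ r R : ℝ} (hr : 0 ≤ r) (hθ : θ ∈ Icc α β)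
    (hαβ : α < β) (hβ : β - α < Real.pi)
    (h : inner ℝ (circlePt ((α + β) / 2)) (r • circlePt θ) <
      (1 - Real.exp (-R)) * Real.cos ((β - α) / 2)) :
    r • circlePt θ ∈ circleParallelogram α β R := by
  set c := 1 - Real.exp (-R)
  have hsin : 0 < Real.sin (β - α) := Real.sin_pos_of_pos_of_lt_pi (by linarith) hβ
  have hcos : 0 < Real.cos ((β - α) / 2) :=
    Real.cos_pos_of_mem_Ioo ⟨by linarith, by linarith⟩
  set a := r * Real.sin (β - θ) / Real.sin (β - α) with ha
  set b := r * Real.sin (θ - α) / Real.sin (β - α) with hb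
  have ha0 : 0 ≤ a := div_nonneg (mul_nonneg hr
    (Real.sin_nonneg_of_nonneg_of_le_pi (by linarith [hθ.2]) (by linarith [hθ.1]))) hsin.le
  have hb0 : 0 ≤ b := div_nonneg (mul_nonneg hr
    (Real.sin_nonneg_of_nonneg_of_le_pi (by linarith [hθ.1]) (by linarith [hθ.2]))) hsin.le
  have e : r • circlePt θ = a • circlePt α + b • circlePt β := by
    have hs := hsin.ne'
    ext i
    fin_cases i
    · show r * Real.cos θ = a * Real.cos α + b * Real.cos β
      rw [ha, hb]
      field_simp
      simp only [Real.sin_sub]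
      ring
    · show r * Real.sin θ = a * Real.sin α + b * Real.sin β
      rw [ha, hb]
      field_simp
      simp only [Real.sin_sub]
      ring
  have hab : a + b < c := by
    rw [e, inner_add_right, inner_smul_right, inner_smul_right, inner_circlePt_circlePt,
      inner_circlePt_circlePt, show (α + β) / 2 - α = (β - α) / 2 by ring,
      show (α + β) / 2 - β = -((β - α) / 2) by ring, Real.cos_neg, ← add_mul] at h
    exact lt_of_mul_lt_mul_right h hcos.le
  refine ⟨!₂[a + b, a - b], ⟨?_, ?_⟩, ?_⟩
  · show a + b ∈ Ioo (-c) c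
    constructor <;> linarith
  · show a - b ∈ Ioo (-c) c
    constructor <;> linarith
  · rw [squareMap_apply, e]
    show ((a + b + (a - b)) / 2) • circlePt α + ((a + b - (a - b)) / 2) • circlePt β = _
    module

theorem tanh_le_one_sub_exp {R : ℝ} (hR : 0 < R) : Real.tanh R ≤ 1 - Real.exp (-R) ^ 2 := by
  have hx := Real.exp_pos (-R)
  have h1 : Real.exp (-R) ≤ 1 := by simpa using hR.le
  have he : Real.exp R = (Real.exp (-R))⁻¹ := by rw [Real.exp_neg, inv_inv]
  rw [Real.tanh_eq_sinh_div_cosh, Real.sinh_eq, Real.cosh_eq, he]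
  generalize Real.exp (-R) = x at *
  have : (x⁻¹ - x) / 2 / ((x⁻¹ + x) / 2) = (1 - x ^ 2) / (1 + x ^ 2) := by field_simp
  rw [this, div_le_iff₀ (by positivity)]
  nlinarith [sq_nonneg x, mul_nonneg (sq_nonneg x) (sub_nonneg.2 h1),
    mul_nonneg (sq_nonneg x) (by nlinarith : 0 ≤ 1 - x ^ 2)]

theorem exp_neg_lt_half {R : ℝ} (hR : 1 ≤ R) : Real.exp (-R) < 1 / 2 := by
  have h1 : Real.exp (-R) ≤ Real.exp (-1) := Real.exp_le_exp.2 (by linarith)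
  have := Real.exp_neg_one_lt_d9
  linarith

theorem exp_neg_three_mul (R : ℝ) : Real.exp (-(3 * R)) = Real.exp (-R) ^ 3 := by
  rw [← Real.exp_nat_mul]
  congr 1
  push_cast
  ring

/-- With x = e^(-R), the ball has ratio at most 1 - x² while parallelograms of parameter 3R have
ratio 1 - x³; the tripled parameter leaves room for the ball. -/
theorem tanh_lt_one_sub_exp {R : ℝ} (hR : 1 ≤ R) : Real.tanh R < 1 - Real.exp (-(3 * R)) := by
  have h1 := tanh_le_one_sub_exp (by linarith : 0 < R)
  have h2 := exp_neg_lt_half hR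
  have hx := Real.exp_pos (-R)
  rw [exp_neg_three_mul]
  generalize Real.exp (-R) = x at *
  nlinarith [pow_pos hx 2]

/-- The chord from angle 0 to 2^(-N) lies at distance cos(2^(-N)/2) from 0. Since 1/4 ≤ 1/e, N ≥ 2R
gives 4^(-N) ≤ x² with x = e^(-R), so this distance is at least 1 - x²/8; and 1 - x² < (1 - x³)(1 -
x²/8) because x < 1/2. -/
theorem tanh_lt_mul_cos {R : ℝ} (hR : 1 ≤ R) {N : ℕ} (hN : 2 * R ≤ N) :
    Real.tanh R < (1 - Real.exp (-(3 * R))) * Real.cos ((2 : ℝ)⁻¹ ^ N / 2) := by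
  have h1 := tanh_le_one_sub_exp (by linarith : 0 < R)
  have h2 := exp_neg_lt_half hR
  have hx := Real.exp_pos (-R)
  have h3 : ((2 : ℝ)⁻¹ ^ N) ^ 2 ≤ Real.exp (-R) ^ 2 := by
    have hq : (4 : ℝ)⁻¹ ≤ Real.exp (-1) := by
      rw [Real.exp_neg]
      exact inv_anti₀ (Real.exp_pos 1) (by linarith [Real.exp_one_lt_d9])
    calc ((2 : ℝ)⁻¹ ^ N) ^ 2 = (4 : ℝ)⁻¹ ^ N := by rw [← pow_mul, mul_comm, pow_mul]; norm_num
      _ ≤ Real.exp (-1) ^ N := by gcongr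
      _ = Real.exp (-N) := by rw [← Real.exp_nat_mul]; simp
      _ ≤ Real.exp (-(2 * R)) := Real.exp_le_exp.2 (by linarith)
      _ = Real.exp (-R) ^ 2 := by rw [← Real.exp_nat_mul]; congr 1; push_cast; ring
  have h4 := Real.one_sub_sq_div_two_le_cos (x := (2 : ℝ)⁻¹ ^ N / 2)
  rw [exp_neg_three_mul]
  generalize Real.exp (-R) = x at *
  have h5 : 1 - x ^ 2 / 8 ≤ Real.cos ((2 : ℝ)⁻¹ ^ N / 2) := by nlinarith
  have hx3 : 0 < 1 - x ^ 3 := by nlinarith [pow_pos hx 2]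
  have hx5 : 0 < x ^ 5 := by positivity
  have h6 := mul_le_mul_of_nonneg_left h5 hx3.le
  nlinarith [pow_pos hx 2, mul_pos (pow_pos hx 2) (sub_pos.2 h2)]

theorem exists_dyadic_interval {θ : ℝ} (N : ℕ) (h1 : (2 : ℝ)⁻¹ ^ N ≤ θ) (h2 : θ ≤ 1) :
    ∃ n < N + 1, (2 : ℝ)⁻¹ ^ (n + 1) ≤ θ ∧ θ ≤ (2 : ℝ)⁻¹ ^ n := by
  induction N with
  | zero =>
    refine ⟨0, by simp, ?_, by simpa using h2⟩
    norm_num at h1 ⊢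
    linarith
  | succ N ih =>
    by_cases h : (2 : ℝ)⁻¹ ^ N ≤ θ
    · obtain ⟨n, hn, hh⟩ := ih h
      exact ⟨n, by omega, hh⟩
    · exact ⟨N, by omega, h1, (not_le.1 h).le⟩

end Circle

end HilbertGeometry
namespace HilbertGeometry

/-! ### The hull of the points ±P_n: symmetry and supporting lines. -/

section Domain

theorem P_eq_circlePt (n : ℕ) : P n = circlePt ((2 : ℝ)⁻¹ ^ n) := rfl

theorem two_inv_pow_mem_Ioc (n : ℕ) : (2 : ℝ)⁻¹ ^ n ∈ Ioc (0 : ℝ) 1 :=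
  ⟨by positivity, pow_le_one₀ (by norm_num) (by norm_num)⟩

/-- The closed convex hull of the points `±P n`. -/
def hullP : Set (E 2) := closure (convexHull ℝ (range P ∪ range (fun n => -P n)))

theorem convex_hullP : Convex ℝ hullP := (convex_convexHull ℝ _).closure

theorem P_mem_hullP (n : ℕ) : P n ∈ hullP :=
  subset_closure (subset_convexHull ℝ _ (Or.inl ⟨n, rfl⟩))

theorem neg_P_mem_hullP (n : ℕ) : -P n ∈ hullP :=
  subset_closure (subset_convexHull ℝ _ (Or.inr ⟨n, rfl⟩))

theorem hullP_subset {K : Set (E 2)} (hK : Convex ℝ K) (hc : IsClosed K) (h1 : ∀ n, P n ∈ K)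
    (h2 : ∀ n, -P n ∈ K) : hullP ⊆ K := by
  refine closure_minimal (convexHull_min ?_ hK) hc
  rintro _ (⟨n, rfl⟩ | ⟨n, rfl⟩)
  exacts [h1 n, h2 n]

theorem neg_mem_hullP {x : E 2} (hx : x ∈ hullP) : -x ∈ hullP :=
  hullP_subset (K := Neg.neg ⁻¹' hullP) (convex_hullP.neg) (isClosed_closure.preimage continuous_neg)
    neg_P_mem_hullP (fun n => by simpa using P_mem_hullP n) hx

theorem hullP_subset_closedBall : hullP ⊆ Metric.closedBall 0 1 :=
  hullP_subset (convex_closedBall _ _) Metric.isClosed_closedBall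
    (fun n => by simp [P_eq_circlePt, norm_circlePt])
    (fun n => by simp [P_eq_circlePt, norm_circlePt])

/-- A strip that contains all the points `±P n` contains their hull. -/
theorem inner_le_of_mem_hullP {m c : ℝ} (h : ∀ n : ℕ, |Real.cos (m - (2 : ℝ)⁻¹ ^ n)| ≤ c)
    {y : E 2} (hy : y ∈ hullP) : inner ℝ (circlePt m) y ≤ c := by
  refine hullP_subset (K := {y | inner ℝ (circlePt m) y ≤ c}) ?_ ?_ ?_ ?_ hy
  · exact convex_halfSpace_le (innerₛₗ ℝ (circlePt m)).isLinear c
  · exact isClosed_le (by fun_prop) continuous_const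
  · intro n
    show inner ℝ (circlePt m) (P n) ≤ c
    rw [P_eq_circlePt, inner_circlePt_circlePt]
    exact (abs_le.1 (h n)).2
  · intro n
    show inner ℝ (circlePt m) (-P n) ≤ c
    rw [inner_neg_right, P_eq_circlePt, inner_circlePt_circlePt]
    linarith [(abs_le.1 (h n)).1]

/-- The line through `P (n + 1)` and `P n` supports the hull. -/
theorem inner_edge_le (n : ℕ) {y : E 2} (hy : y ∈ hullP) :
    inner ℝ (circlePt (((2 : ℝ)⁻¹ ^ (n + 1) + (2 : ℝ)⁻¹ ^ n) / 2)) y ≤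
      Real.cos (((2 : ℝ)⁻¹ ^ n - (2 : ℝ)⁻¹ ^ (n + 1)) / 2) := by
  refine inner_le_of_mem_hullP (fun k => ?_) hy
  have ht := two_inv_pow_mem_Ioc k
  have hn := two_inv_pow_mem_Ioc n
  have hs : (2 : ℝ)⁻¹ ^ (n + 1) = (2 : ℝ)⁻¹ ^ n / 2 := by rw [pow_succ]; ring
  have hpi := Real.pi_gt_three
  rw [hs]
  -- No angle 2^(-k) falls strictly between two consecutive ones, so each is at least half the gap
  -- away from the bisecting angle.
  have hk : (2 : ℝ)⁻¹ ^ k ≤ (2 : ℝ)⁻¹ ^ n / 2 ∨ (2 : ℝ)⁻¹ ^ n ≤ (2 : ℝ)⁻¹ ^ k := by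
    rcases Nat.lt_or_ge n k with h | h
    · left
      rw [← hs]
      exact pow_le_pow_of_le_one (by norm_num) (by norm_num) h
    · right
      exact pow_le_pow_of_le_one (by norm_num) (by norm_num) h
  set a := (2 : ℝ)⁻¹ ^ n
  set b := (2 : ℝ)⁻¹ ^ k
  rw [abs_of_nonneg (Real.cos_nonneg_of_mem_Icc
    ⟨by linarith [ht.2, hn.1], by linarith [ht.1, hn.2]⟩), ← Real.cos_abs ((a / 2 + a) / 2 - b)]
  refine Real.cos_le_cos_of_nonneg_of_le_pi (by linarith [hn.1]) ?_ ?_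
  · rw [abs_le]
    constructor <;> linarith [ht.1, ht.2, hn.1, hn.2]
  · rw [le_abs]
    rcases hk with h | h
    · left; linarith
    · right; linarith

/-- The line through `P 0` and `(-1, 0)` supports the hull. -/
theorem inner_long_edge_le {y : E 2} (hy : y ∈ hullP) :
    inner ℝ (circlePt ((1 + Real.pi) / 2)) y ≤ Real.cos ((Real.pi - 1) / 2) := by
  refine inner_le_of_mem_hullP (fun k => ?_) hy
  have ht := two_inv_pow_mem_Ioc k
  have hpi := Real.pi_gt_three
  -- The upper bound is attained at P_0; the lower one is approached as k grows, when -P_k tends to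
  -- (-1, 0).
  rw [abs_le]
  constructor
  · rw [← Real.cos_pi_sub]
    exact Real.cos_le_cos_of_nonneg_of_le_pi (by linarith [ht.2]) (by linarith) (by linarith [ht.1])
  · exact Real.cos_le_cos_of_nonneg_of_le_pi (by linarith) (by linarith [ht.1]) (by linarith [ht.2])

/-- The point (1, 0) is only a limit of the P_n, which is why the closed hull is used. -/
theorem circlePt_zero_mem_hullP : circlePt 0 ∈ hullP := by
  have : Tendsto (fun n : ℕ => circlePt ((2 : ℝ)⁻¹ ^ n)) atTop (𝓝 (circlePt 0)) :=
    (continuous_circlePt.tendsto 0).comp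
      (tendsto_pow_atTop_nhds_zero_of_lt_one (by norm_num) (by norm_num))
  exact isClosed_closure.mem_of_tendsto this (Eventually.of_forall P_mem_hullP)

theorem circlePt_pi_mem_hullP : circlePt Real.pi ∈ hullP := by
  have := neg_mem_hullP circlePt_zero_mem_hullP
  rwa [neg_circlePt, zero_add] at this

theorem sin_ne_zero_of_lt {a b : ℝ} (h : a < b) (h' : b - a < Real.pi) : Real.sin (b - a) ≠ 0 :=
  (Real.sin_pos_of_pos_of_lt_pi (sub_pos.2 h) h').ne'

theorem two_inv_pow_succ_lt (n : ℕ) : (2 : ℝ)⁻¹ ^ (n + 1) < (2 : ℝ)⁻¹ ^ n :=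
  pow_lt_pow_right_of_lt_one₀ (by norm_num) (by norm_num) n.lt_succ_self

theorem two_inv_pow_sub_lt_pi (n k : ℕ) : (2 : ℝ)⁻¹ ^ n - (2 : ℝ)⁻¹ ^ k < Real.pi := by
  linarith [(two_inv_pow_mem_Ioc n).2, (two_inv_pow_mem_Ioc k).1, Real.pi_gt_three]

theorem zero_mem_domainC : (0 : E 2) ∈ domainC := by
  have hs : ∀ x ∈ convexHull ℝ (range P ∪ range (fun n => -P n)),
      -x ∈ convexHull ℝ (range P ∪ range (fun n => -P n)) := by
    intro x hx
    refine convexHull_min (t := Neg.neg ⁻¹' convexHull ℝ (range P ∪ range (fun n => -P n)))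
      ?_ (convex_convexHull ℝ _).neg hx
    rintro _ (⟨n, rfl⟩ | ⟨n, rfl⟩)
    · exact subset_convexHull ℝ _ (Or.inr ⟨n, rfl⟩)
    · exact subset_convexHull ℝ _ (Or.inl ⟨n, by simp⟩)
  have := squareMap_mem_interior (convex_convexHull ℝ _) hs
    (subset_convexHull ℝ _ (Or.inl ⟨1, rfl⟩)) (subset_convexHull ℝ _ (Or.inl ⟨0, rfl⟩))
    (linearIndependent_circlePt
      (sin_ne_zero_of_lt (two_inv_pow_succ_lt 0) (two_inv_pow_sub_lt_pi 0 1))) (z := 0)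
      (by simp) (by simp)
  rwa [map_zero] at this

theorem closure_domainC : closure domainC = hullP :=
  (convex_convexHull ℝ _).closure_interior_eq_closure_of_nonempty_interior ⟨0, zero_mem_domainC⟩

theorem domainC_subset : domainC ⊆ hullP := interior_subset.trans subset_closure

theorem domainC_eq_interior_hullP : domainC = interior hullP :=
  ((convex_convexHull ℝ _).interior_closure_eq_interior_of_nonempty_interior
    ⟨0, zero_mem_domainC⟩).symm

theorem isHilbertDomain_domainC : IsHilbertDomain domainC :=
  ⟨⟨0, zero_mem_domainC⟩, isOpen_interior,
    Metric.isBounded_closedBall.subset (domainC_subset.trans hullP_subset_closedBall),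
    (convex_convexHull ℝ _).interior⟩

theorem neg_mem_domainC : ∀ x ∈ domainC, -x ∈ domainC := by
  intro x hx
  rw [domainC_eq_interior_hullP] at hx ⊢
  have : interior hullP ⊆ Neg.neg ⁻¹' hullP := fun y hy => neg_mem_hullP (interior_subset hy)
  have h2 := interior_maximal (s := hullP) (t := Neg.neg ⁻¹' interior hullP)
    (fun y hy => by simpa using this hy) (isOpen_interior.preimage continuous_neg)
  exact h2 (by simpa using hx)

end Domain

/-! ### Infinitely many vertices; comparison with polygons. -/

section Vertices

/-- The lines of the two edges meeting at this point, towards P_{n+2} and towards P_n, both support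
the hull. -/
theorem isVertex_P_succ (n : ℕ) : IsVertex (closure domainC) (P (n + 1)) := by
  rw [closure_domainC]
  have hn := two_inv_pow_mem_Ioc n
  have hs : (2 : ℝ)⁻¹ ^ (n + 1) = (2 : ℝ)⁻¹ ^ n / 2 := by rw [pow_succ]; ring
  have hs' : (2 : ℝ)⁻¹ ^ (n + 1 + 1) = (2 : ℝ)⁻¹ ^ (n + 1) / 2 := by rw [pow_succ _ (n + 1)]; ring
  refine ⟨P_mem_hullP _, circlePt (((2 : ℝ)⁻¹ ^ (n + 1 + 1) + (2 : ℝ)⁻¹ ^ (n + 1)) / 2),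
    circlePt (((2 : ℝ)⁻¹ ^ (n + 1) + (2 : ℝ)⁻¹ ^ n) / 2), ?_, fun y hy => ⟨?_, ?_⟩⟩
  · refine linearIndependent_circlePt (sin_ne_zero_of_lt ?_ ?_) <;>
      linarith [hn.1, hn.2, Real.pi_gt_three]
  · refine (inner_edge_le (n + 1) hy).trans_eq ?_
    rw [P_eq_circlePt, inner_circlePt_circlePt, ← Real.cos_neg]
    congr 1
    ring
  · refine (inner_edge_le n hy).trans_eq ?_
    rw [P_eq_circlePt, inner_circlePt_circlePt]
    congr 1
    ring

theorem P_injective : Function.Injective P := by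
  intro a b h
  have h0 : Real.cos ((2 : ℝ)⁻¹ ^ a) = Real.cos ((2 : ℝ)⁻¹ ^ b) := by
    simpa [P] using congrArg (fun z : E 2 => z 0) h
  have hmem : ∀ n : ℕ, (2 : ℝ)⁻¹ ^ n ∈ Icc 0 Real.pi := fun n =>
    ⟨(two_inv_pow_mem_Ioc n).1.le, by linarith [(two_inv_pow_mem_Ioc n).2, Real.pi_gt_three]⟩
  exact pow_right_injective₀ (by norm_num) (by norm_num) (Real.injOn_cos (hmem a) (hmem b) h0)

theorem infinite_vertices : {x | IsVertex (closure domainC) x}.Infinite :=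
  Set.infinite_of_injective_forall_mem (P_injective.comp (add_left_injective 1)) isVertex_P_succ

/-- If a proper convex combination maximises a linear functional, so do both endpoints. Two
independent normals span the plane, so the endpoints coincide with the combination. -/
theorem IsVertex.mem_extremePoints {K : Set (E 2)} {x : E 2} (h : IsVertex K x) :
    x ∈ K.extremePoints ℝ := by
  obtain ⟨hx, u, w, hind, hsup⟩ := h
  refine ⟨hx, ?_⟩
  rintro y hy z hz ⟨a, b, ha, hb, hab, rfl⟩
  have hspan : Submodule.span ℝ (range ![u, w]) = ⊤ :=
    hind.span_eq_top_of_card_eq_finrank (by simp)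
  have key : ∀ n ∈ range ![u, w], inner ℝ n (y - (a • y + b • z)) = 0 := by
    have aux : ∀ n : E 2, inner ℝ n y ≤ inner ℝ n (a • y + b • z) →
        inner ℝ n z ≤ inner ℝ n (a • y + b • z) → inner ℝ n (y - (a • y + b • z)) = 0 := by
      intro n h1 h2
      rw [inner_sub_right]
      rw [inner_add_right, inner_smul_right, inner_smul_right] at *
      have hb' : b = 1 - a := by linarith
      subst hb'
      have h3 : inner ℝ n z ≤ inner ℝ n y := by nlinarith
      have h4 : inner ℝ n y ≤ inner ℝ n z := by nlinarith
      rw [le_antisymm h3 h4]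
      ring
    rintro _ ⟨i, rfl⟩
    fin_cases i
    · exact aux u (hsup y hy).1 (hsup z hz).1
    · exact aux w (hsup y hy).2 (hsup z hz).2
  have hall : ∀ n : E 2, inner ℝ n (y - (a • y + b • z)) = 0 := by
    intro n
    have hn : n ∈ Submodule.span ℝ (range ![u, w]) := hspan ▸ Submodule.mem_top
    induction hn using Submodule.span_induction with
    | mem n hn => exact key n hn
    | zero => exact inner_zero_left _
    | add p q _ _ hp hq => rw [inner_add_left, hp, hq, add_zero]
    | smul c p _ hp => rw [inner_smul_left, hp, mul_zero]
  exact sub_eq_zero.1 (inner_self_eq_zero.1 (hall _))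

theorem IsOpenPolygon.finite_vertices {C : Set (E 2)} (hC : IsOpenPolygon C) (hne : C.Nonempty) :
    {x | IsVertex (closure C) x}.Finite := by
  obtain ⟨F, hF, rfl⟩ := hC
  refine hF.subset fun x hx => ?_
  have hx' := IsVertex.mem_extremePoints hx
  rw [(convex_convexHull ℝ F).closure_interior_eq_closure_of_nonempty_interior hne,
    (hF.isClosed_convexHull ℝ).closure_eq] at hx'
  exact extremePoints_convexHull_subset hx'

end Vertices

/-! ### Covering the balls, cubic growth and entropy. -/

section Growth

theorem hilbertMeasure_circleParallelogram_le {α β R : ℝ} (hα : circlePt α ∈ hullP)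
    (hβ : circlePt β ∈ hullP) (hαβ : α < β) (hlt : β - α < Real.pi) (hR : 1 ≤ R) :
    hilbertMeasure domainC (circleParallelogram α β (3 * R)) ≤
      volume (Metric.ball (0 : E 2) 1) * ENNReal.ofReal (64 * R ^ 2) := by
  rw [← closure_domainC] at hα hβ
  refine (hilbertMeasure_parallelogram_le isHilbertDomain_domainC neg_mem_domainC hα hβ
    (linearIndependent_circlePt (sin_ne_zero_of_lt hαβ hlt)) (by linarith)).trans ?_
  have hl := Real.log_two_lt_d9
  have hl0 : 0 < Real.log 2 := Real.log_pos (by norm_num)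
  -- Since log 2 < 1 ≤ R, 2 log 2 + 2(3R) ≤ 8R, whence the constant 64.
  rw [← ENNReal.ofReal_pow (by positivity), show 64 * R ^ 2 = (8 * R) ^ 2 by ring]
  gcongr
  linarith

/-- The ball of radius `R` is covered by `O(R)` parallelograms. -/
theorem hilbertBall_subset {R : ℝ} (hR : 1 ≤ R) {N : ℕ} (hN : 2 * R ≤ N) :
    hilbertBall domainC 0 R ⊆
      (⋃ n ∈ Finset.range (N + 1),
        circleParallelogram ((2 : ℝ)⁻¹ ^ (n + 1)) ((2 : ℝ)⁻¹ ^ n) (3 * R)) ∪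
      (circleParallelogram 0 ((2 : ℝ)⁻¹ ^ N) (3 * R) ∪
        circleParallelogram 1 Real.pi (3 * R)) := by
  have hR0 : 0 < R := by linarith
  have hT0 : 0 < Real.tanh R := by
    rw [Real.tanh_eq_sinh_div_cosh]
    exact div_pos (Real.sinh_pos_iff.2 hR0) (Real.cosh_pos R)
  have hpi := Real.pi_gt_three
  have key : ∀ r θ : ℝ, 0 ≤ r → θ ∈ Icc 0 Real.pi →
      (Real.tanh R)⁻¹ • (r • circlePt θ) ∈ domainC → r • circlePt θ ∈
      (⋃ n ∈ Finset.range (N + 1),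
        circleParallelogram ((2 : ℝ)⁻¹ ^ (n + 1)) ((2 : ℝ)⁻¹ ^ n) (3 * R)) ∪
      (circleParallelogram 0 ((2 : ℝ)⁻¹ ^ N) (3 * R) ∪
        circleParallelogram 1 Real.pi (3 * R)) := by
    intro r θ hr hθ hmem
    have hh := domainC_subset hmem
    have hscale : ∀ u : E 2, inner ℝ u (r • circlePt θ) =
        Real.tanh R * inner ℝ u ((Real.tanh R)⁻¹ • (r • circlePt θ)) := by
      intro u
      rw [inner_smul_right _ _ (Real.tanh R)⁻¹, mul_inv_cancel_left₀ hT0.ne']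
    have hedge : ∀ {u : E 2} {c : ℝ}, 0 < c →
        (∀ y ∈ hullP, inner ℝ u y ≤ c) →
        inner ℝ u (r • circlePt θ) < (1 - Real.exp (-(3 * R))) * c := by
      intro u c hc hu
      rw [hscale]
      calc _ ≤ Real.tanh R * c := by gcongr; exact hu _ hh
        _ < _ := by gcongr; exact tanh_lt_one_sub_exp hR
    by_cases h1 : 1 ≤ θ
    · refine Or.inr (Or.inr (smul_circlePt_mem_circleParallelogram hr ⟨h1, hθ.2⟩ (by linarith)
        (by linarith) (hedge (Real.cos_pos_of_mem_Ioo ⟨by linarith, by linarith⟩)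
          fun y hy => inner_long_edge_le hy)))
    by_cases h2 : (2 : ℝ)⁻¹ ^ N ≤ θ
    · obtain ⟨n, hn, h3, h4⟩ := exists_dyadic_interval N h2 (not_le.1 h1).le
      have hlt := two_inv_pow_succ_lt n
      have hpi' := two_inv_pow_sub_lt_pi n (n + 1)
      refine Or.inl (mem_biUnion (Finset.mem_coe.2 (Finset.mem_range.2 hn))
        (smul_circlePt_mem_circleParallelogram hr ⟨h3, h4⟩ hlt hpi'
        (hedge (Real.cos_pos_of_mem_Ioo ⟨by linarith, by linarith⟩) fun y hy => inner_edge_le n hy)))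
    · have hN' := two_inv_pow_mem_Ioc N
      refine Or.inr (Or.inl (smul_circlePt_mem_circleParallelogram hr ⟨hθ.1, (not_le.1 h2).le⟩ hN'.1
        (by linarith [hN'.2]) ?_))
      rw [sub_zero, hscale]
      refine lt_of_le_of_lt ?_ (tanh_lt_mul_cos hR hN)
      -- This chord does not support the hull, so only the inclusion of the hull in the unit disc is
      -- used.
      refine mul_le_of_le_one_right hT0.le ((real_inner_le_norm _ _).trans ?_)
      rw [norm_circlePt, one_mul]
      simpa using hullP_subset_closedBall hh
  intro p hp
  rw [mem_hilbertBall_zero_iff isHilbertDomain_domainC neg_mem_domainC zero_mem_domainC hR0] at hp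
  obtain ⟨r, θ, hr, hθ, hpos | hneg⟩ := exists_polar p
  · rw [hpos] at hp ⊢
    exact key r θ hr hθ hp
  · have hp' : (Real.tanh R)⁻¹ • (r • circlePt θ) ∈ domainC := by
      rw [← hneg, smul_neg]
      exact neg_mem_domainC _ hp
    have := key r θ hr hθ hp'
    rw [← hneg] at this
    simp only [mem_union, mem_iUnion] at this ⊢
    rcases this with ⟨n, hn, h⟩ | h | h
    · exact Or.inl ⟨n, hn, neg_mem_circleParallelogram h⟩
    · exact Or.inr (Or.inl (neg_mem_circleParallelogram h))
    · exact Or.inr (Or.inr (neg_mem_circleParallelogram h))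

theorem hilbertMeasure_hilbertBall_le {R : ℝ} (hR : 1 ≤ R) :
    hilbertMeasure domainC (hilbertBall domainC 0 R) ≤
      ENNReal.ofReal ((volume (Metric.ball (0 : E 2) 1)).toReal * 384 * R ^ 3) := by
  set ω := volume (Metric.ball (0 : E 2) 1)
  have hω : ω ≠ ⊤ := Metric.isBounded_ball.measure_lt_top.ne
  set N := ⌈2 * R⌉₊
  have hN : 2 * R ≤ N := Nat.le_ceil _
  have hN' : (N : ℝ) < 2 * R + 1 := Nat.ceil_lt_add_one (by linarith)
  have hpi := Real.pi_gt_three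
  have hNm := two_inv_pow_mem_Ioc N
  refine (measure_mono (hilbertBall_subset hR hN)).trans ((measure_union_le _ _).trans ?_)
  calc _ ≤ (∑ n ∈ Finset.range (N + 1), ω * ENNReal.ofReal (64 * R ^ 2)) +
        (ω * ENNReal.ofReal (64 * R ^ 2) + ω * ENNReal.ofReal (64 * R ^ 2)) := by
        refine add_le_add ((measure_biUnion_finset_le _ _).trans (Finset.sum_le_sum fun n _ => ?_))
          ((measure_union_le _ _).trans (add_le_add ?_ ?_))
        · exact hilbertMeasure_circleParallelogram_le (P_mem_hullP _) (P_mem_hullP _)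
            (two_inv_pow_succ_lt n) (two_inv_pow_sub_lt_pi _ _) hR
        · exact hilbertMeasure_circleParallelogram_le circlePt_zero_mem_hullP (P_mem_hullP _)
            hNm.1 (by linarith [hNm.2]) hR
        · refine hilbertMeasure_circleParallelogram_le ?_ circlePt_pi_mem_hullP
            (by linarith) (by linarith) hR
          simpa [P_eq_circlePt] using P_mem_hullP 0
    _ = ENNReal.ofReal (ω.toReal * ((N + 3) * (64 * R ^ 2))) := by
        rw [Finset.sum_const, Finset.card_range, nsmul_eq_mul, ENNReal.ofReal_mul ENNReal.toReal_nonneg,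
          ENNReal.ofReal_toReal hω, ENNReal.ofReal_mul (p := (N : ℝ) + 3) (by positivity),
          ENNReal.ofReal_add (by positivity) (by norm_num), ENNReal.ofReal_natCast]
        push_cast
        rw [ENNReal.ofReal_ofNat]
        ring
    _ ≤ _ := by
        refine ENNReal.ofReal_le_ofReal ?_
        rw [mul_assoc]
        refine mul_le_mul_of_nonneg_left ?_ ENNReal.toReal_nonneg
        -- There are N + 3 parallelograms, and N + 3 < 2R + 4 ≤ 6R; then 384 = 6 · 64.
        have : (N : ℝ) + 3 ≤ 6 * R := by linarith
        calc ((N : ℝ) + 3) * (64 * R ^ 2) ≤ (6 * R) * (64 * R ^ 2) := by gcongr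
          _ = 384 * R ^ 3 := by ring

theorem hilbertBall_mono {m : ℕ} (C : Set (E m)) (p : E m) {r R : ℝ} (h : r ≤ R) :
    hilbertBall C p r ⊆ hilbertBall C p R := fun _ hq => ⟨hq.1, hq.2.trans_le h⟩

theorem hilbertMeasure_hilbertBall_pos {R : ℝ} (hR : 0 < R) :
    0 < hilbertMeasure domainC (hilbertBall domainC 0 R) := by
  have he : hilbertBall domainC 0 R = (fun q => (Real.tanh R)⁻¹ • q) ⁻¹' domainC := by
    ext q
    exact mem_hilbertBall_zero_iff isHilbertDomain_domainC neg_mem_domainC zero_mem_domainC hR q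
  refine hilbertMeasure_pos isHilbertDomain_domainC ?_ ⟨0, ?_⟩ fun q hq => hq.1
  · rw [he]
    exact isHilbertDomain_domainC.2.1.preimage (continuous_const_smul _)
  · rw [he]
    simpa using zero_mem_domainC

theorem hilbertMeasure_hilbertBall_lt_top (R : ℝ) :
    hilbertMeasure domainC (hilbertBall domainC 0 R) < ⊤ :=
  (measure_mono (hilbertBall_mono _ _ (le_max_left R 1))).trans_lt
    ((hilbertMeasure_hilbertBall_le (le_max_right R 1)).trans_lt ENNReal.ofReal_lt_top)

/-- For R ≥ 1 the volume lies between its value at 1 and K R³, and both logarithms are o(R). -/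
theorem hasVolumeGrowthEntropy_domainC : HasVolumeGrowthEntropy domainC 0 := by
  set V : ℝ → ℝ := fun R => (hilbertMeasure domainC (hilbertBall domainC 0 R)).toReal
  have hVpos : ∀ R, 0 < R → 0 < V R := fun R hR =>
    ENNReal.toReal_pos (hilbertMeasure_hilbertBall_pos hR).ne' (hilbertMeasure_hilbertBall_lt_top R).ne
  set K := (volume (Metric.ball (0 : E 2) 1)).toReal * 384
  have hK : 0 < K := mul_pos (ENNReal.toReal_pos (Metric.measure_ball_pos _ _ one_pos).ne'
    Metric.isBounded_ball.measure_lt_top.ne) (by norm_num)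
  have hup : ∀ R, 1 ≤ R → V R ≤ K * R ^ 3 := fun R hR =>
    ENNReal.toReal_le_of_le_ofReal (by positivity) (hilbertMeasure_hilbertBall_le hR)
  have hlow : ∀ R, 1 ≤ R → V 1 ≤ V R := fun R hR =>
    ENNReal.toReal_mono (hilbertMeasure_hilbertBall_lt_top R).ne
      (measure_mono (hilbertBall_mono _ _ hR))
  have hinv : Tendsto (fun R : ℝ => 1 / R) atTop (𝓝 0) := by
    simpa using tendsto_inv_atTop_zero (𝕜 := ℝ)
  have hlog : Tendsto (fun R : ℝ => Real.log R / R) atTop (𝓝 0) :=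
    Real.isLittleO_log_id_atTop.tendsto_div_nhds_zero
  have l1 : Tendsto (fun R : ℝ => 1 / R * Real.log (V 1)) atTop (𝓝 0) := by
    simpa using hinv.mul_const (Real.log (V 1))
  have l2 : Tendsto (fun R : ℝ => 1 / R * Real.log K + 3 * (Real.log R / R)) atTop (𝓝 0) := by
    simpa using (hinv.mul_const (Real.log K)).add (hlog.const_mul 3)
  refine tendsto_of_tendsto_of_tendsto_of_le_of_le' l1 l2 ?_ ?_
  · filter_upwards [eventually_ge_atTop 1] with R hR
    have hR0 : 0 < R := by linarith
    exact mul_le_mul_of_nonneg_left (Real.log_le_log (hVpos 1 one_pos) (hlow R hR)) (by positivity)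
  · filter_upwards [eventually_ge_atTop 1] with R hR
    have hR0 : 0 < R := by linarith
    have h1 : Real.log (V R) ≤ Real.log K + 3 * Real.log R := by
      refine (Real.log_le_log (hVpos R hR0) (hup R hR)).trans_eq ?_
      rw [Real.log_mul hK.ne' (by positivity), Real.log_pow]
      norm_num
    calc 1 / R * Real.log (V R) ≤ 1 / R * (Real.log K + 3 * Real.log R) := by gcongr
      _ = _ := by ring

end Growth

end HilbertGeometry

theorem theorem4p2 :
    HilbertGeometry.IsHilbertDomain HilbertGeometry.domainC ∧
    (0 : HilbertGeometry.E 2) ∈ HilbertGeometry.domainC ∧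
    ¬ HilbertGeometry.IsOpenPolygon HilbertGeometry.domainC ∧
    {x | HilbertGeometry.IsVertex (closure HilbertGeometry.domainC) x}.Infinite ∧
    (∀ R : ℝ, 0 < R →
      0 < HilbertGeometry.hilbertMeasure HilbertGeometry.domainC
        (HilbertGeometry.hilbertBall HilbertGeometry.domainC 0 R) ∧
      HilbertGeometry.hilbertMeasure HilbertGeometry.domainC
        (HilbertGeometry.hilbertBall HilbertGeometry.domainC 0 R) < ⊤) ∧
    HilbertGeometry.HasVolumeGrowthEntropy HilbertGeometry.domainC 0 ∧
    ∃ K : ℝ, ∀ R : ℝ, 1 ≤ R →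
      HilbertGeometry.hilbertMeasure HilbertGeometry.domainC
        (HilbertGeometry.hilbertBall HilbertGeometry.domainC 0 R) ≤
        ENNReal.ofReal (K * R ^ 3) :=
  ⟨HilbertGeometry.isHilbertDomain_domainC, HilbertGeometry.zero_mem_domainC,
    fun h => HilbertGeometry.infinite_vertices
      (h.finite_vertices ⟨0, HilbertGeometry.zero_mem_domainC⟩),
    HilbertGeometry.infinite_vertices,
    fun R hR => ⟨HilbertGeometry.hilbertMeasure_hilbertBall_pos hR,
      HilbertGeometry.hilbertMeasure_hilbertBall_lt_top R⟩,
    HilbertGeometry.hasVolumeGrowthEntropy_domainC,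
    _, fun _ hR => HilbertGeometry.hilbertMeasure_hilbertBall_le hR⟩
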